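/- Let $S^1=\mathbb R/\mathbb Z$ and let $q=(q(x))_{x\in S^1}$ be a Gaussian process with almost surely continuous paths, $E[q(x)]=0$ and $E[q(x)q(y)]=K(x-y)$ for all $x,y\in S^1$, where $K:S^1\to\mathbb R$ is continuous. Let $\mathbf K$ be the covariance operator $\mathbf Kf(x)=\int_0^1K(x-y)f(y)\,dy$, and assume the normalization $\mathbf K1=1$. For continuous $q$ let $\Lambda_0(q)$ be the ground state (lowest) eigenvalue of Hill's operator $-\frac{d^2}{dx^2}+q(x)$ with periodic boundary conditions on $[0,1)$. Let $H$ be the space of continuous functions on $S^1$ with mean zero, let $P$ be the law of $q$ on $C(S^1)$, and let $\tilde P$ be the law on $H$ of $\tilde q=q-\int_0^1q$. Then: (1) Almost surely the lowest eigenvalue $\Lambda_0(q)$ exists. (2) For each $\tilde q\in H$ there is exactly one $1$-periodic $C^1$ function $\tilde p$ which satisfies $\int_0^1\tilde p=0$ (zero log-multiplier) and, for some $\mu\in\mathbb R$, solves the Riccati equation $\tilde q=\mu+\tilde p'+\tilde p^2$. Hence $\Phi(\tilde q)=\int_0^1\tilde p^2\ge 0$ is well defined on $H$. (3) $\Lambda_0(q)$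 is a random variable, measurable up to null events, and its law has, with respect to Lebesgue measure on $\mathbb R$, the density $$f(\lambda)=\frac1{\sqrt{2\pi}}\int_H e^{-\frac12(\lambda+\Phi(\tilde q))^2}\,d\tilde P(\tilde q),\qquad \lambda\in\mathbb R.$$ (4) $f$ is $C^\infty$ on $\mathbb R$ and $f(\lambda)>0$ for every $\lambda\in\mathbb R$. -/

import Mathlib

open MeasureTheory ProbabilityTheory


noncomputable section

namespace Hill

/-! The circle `S¹ = [0,1)` is `UnitAddCircle = ℝ ⧸ ℤ`; its `volume` has total mass one. Functions
such as `ψ` and `p`, which are differentiated, are written as `1`-periodic functions on `ℝ`. -/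

/-- A continuous, mean-zero Gaussian potential on the circle with covariance kernel `K(x - y)`. -/
structure IsGaussianPotential {Ω : Type*} [MeasurableSpace Ω] (Pr : Measure Ω)
    (q : UnitAddCircle → Ω → ℝ) (K : UnitAddCircle → ℝ) : Prop where
  gaussian : IsGaussianProcess q Pr
  ae_continuous : ∀ᵐ ω ∂Pr, Continuous fun x => q x ω
  mean_zero : ∀ x, ∫ ω, q x ω ∂Pr = 0
  covariance : ∀ x y, ∫ ω, q x ω * q y ω ∂Pr = K (x - y)
  continuous_kernel : Continuous K

/-- The covariance operator `𝐊 f (x) = ∫ K(x - y) f(y) dy`. -/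
def covOp (K f : UnitAddCircle → ℝ) (x : UnitAddCircle) : ℝ :=
  ∫ y, K (x - y) * f y

/-- `ψ` is an eigenfunction, with eigenvalue `μ`, of Hill's operator `-d²/dx² + q` with periodic
boundary conditions. -/
structure IsEigenfunction (q : UnitAddCircle → ℝ) (μ : ℝ) (ψ : ℝ → ℝ) : Prop where
  contDiff : ContDiff ℝ 2 ψ
  periodic : Function.Periodic ψ 1
  ne_zero : ψ ≠ 0
  eqn : ∀ x : ℝ, -deriv (deriv ψ) x + q x * ψ x = μ * ψ x

/-- The eigenvalues of Hill's operator `-d²/dx² + q` with periodic boundary conditions. -/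
def eigenvalues (q : UnitAddCircle → ℝ) : Set ℝ :=
  {μ | ∃ ψ, IsEigenfunction q μ ψ}

/-- The ground state eigenvalue `Λ₀(q)`. -/
def groundState (q : UnitAddCircle → ℝ) : ℝ :=
  sInf (eigenvalues q)

/-- `p` is a periodic solution of the Riccati equation `q = μ + p' + p²`. -/
structure IsRiccatiSolution (q : UnitAddCircle → ℝ) (μ : ℝ) (p : ℝ → ℝ) : Prop where
  contDiff : ContDiff ℝ 1 p
  periodic : Function.Periodic p 1
  eqn : ∀ x : ℝ, q x = μ + deriv p x + p x ^ 2

/-- The log-multiplier `s = ∫₀¹ p` of a periodic Riccati solution. -/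
def logMultiplier (p : ℝ → ℝ) : ℝ :=
  ∫ x in (0 : ℝ)..1, p x

/-- `p` solves the Riccati equation of `q`, for some value of the spectral parameter, with zero
log-multiplier. As `p` then has mean zero, it is its own mean-zero part `p̃`. -/
def IsZeroMultiplierSolution (q : UnitAddCircle → ℝ) (p : ℝ → ℝ) : Prop :=
  (∃ μ, IsRiccatiSolution q μ p) ∧ logMultiplier p = 0

/-- The Borel σ-algebra of the uniform topology on continuous paths. -/
instance : MeasurableSpace C(UnitAddCircle, ℝ) := borel _

instance : BorelSpace C(UnitAddCircle, ℝ) := ⟨rfl⟩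

/-- The space `H` of continuous, mean-zero paths on the circle, with the Borel σ-algebra. -/
abbrev H : Type := {g : C(UnitAddCircle, ℝ) // ∫ x, g x = 0}

open Classical in
/-- The functional `Φ(q̃) = ∫₀¹ p̃²`, where `p̃` is the Riccati solution of `q̃` with zero
log-multiplier. -/
def Phi (g : H) : ℝ :=
  if h : ∃ p, IsZeroMultiplierSolution g.1 p then ∫ x in (0 : ℝ)..1, h.choose x ^ 2 else 0

open Classical in
/-- The path `x ↦ q(x)` as an element of `C(S¹)`, with the value `0` on the exceptional event that
it is not continuous. -/
def path {Ω : Type*} (q : UnitAddCircle → Ω → ℝ) (ω : Ω) : C(UnitAddCircle, ℝ) :=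
  if h : Continuous fun x => q x ω then ⟨fun x => q x ω, h⟩ else 0

/-- The law `P` of `q` on `C(S¹)`. -/
def law {Ω : Type*} [MeasurableSpace Ω] (Pr : Measure Ω) (q : UnitAddCircle → Ω → ℝ) :
    Measure C(UnitAddCircle, ℝ) :=
  Pr.map (path q)

/-- The mean-zero part `q̃ = q - ∫ q`. -/
def tilde (g : C(UnitAddCircle, ℝ)) : H :=
  ⟨g - ContinuousMap.const _ (∫ x, g x), by
    have hg : Integrable (fun x => g x) (volume : Measure UnitAddCircle) :=
      g.continuous.integrable_of_hasCompactSupport (HasCompactSupport.of_compactSpace _)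
    simp only [ContinuousMap.sub_apply, ContinuousMap.const_apply]
    rw [integral_sub hg (integrable_const _)]
    simp [Measure.real]⟩

/-- The law `P̃` of `q̃ = q - ∫ q`, the image of the law `P` of `q`. -/
def tildeLaw {Ω : Type*} [MeasurableSpace Ω] (Pr : Measure Ω) (q : UnitAddCircle → Ω → ℝ) :
    Measure H :=
  (law Pr q).map tilde

/-- `f(t) = (2π)^{-1/2} ∫_H exp(-(t + Φ(q̃))² / 2) dP̃(q̃)`. -/
def density {Ω : Type*} [MeasurableSpace Ω] (Pr : Measure Ω) (q : UnitAddCircle → Ω → ℝ)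
    (t : ℝ) : ℝ :=
  1 / Real.sqrt (2 * Real.pi) * ∫ g, Real.exp (-(1 / 2) * (t + Phi g) ^ 2) ∂(tildeLaw Pr q)

end Hill

end

namespace Hill

open Filter Topology Set
open scoped ENNReal NNReal Polynomial

/-! ### Periodic functions, linear equations and a comparison principle -/

lemma exists_forall_le_of_periodic {f : ℝ → ℝ} (hf : Continuous f) (hp : f.Periodic 1) :
    ∃ x₀, ∀ x, f x ≤ f x₀ := by
  obtain ⟨x₀, -, h⟩ := isCompact_Icc.exists_isMaxOn (⟨0, by simp⟩ : (Icc (0 : ℝ) 1).Nonempty)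
    hf.continuousOn
  refine ⟨x₀, fun x => ?_⟩
  obtain ⟨y, hy, hxy⟩ := hp.exists_mem_Ico₀ one_pos x
  rw [hxy]
  exact h ⟨hy.1, hy.2.le⟩

lemma exists_abs_le_of_periodic {f : ℝ → ℝ} (hf : Continuous f) (hp : f.Periodic 1) :
    ∃ B, 0 < B ∧ ∀ x, |f x| ≤ B := by
  obtain ⟨x₀, h⟩ := exists_forall_le_of_periodic hf.abs (fun x => by rw [hp x])
  exact ⟨|f x₀| + 1, by positivity, fun x => (h x).trans (by linarith)⟩

/-- The equation `h' + a h = f` has a periodic solution if `a` does not have mean zero. -/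
lemma exists_periodic_linear {a f : ℝ → ℝ} (ha : Continuous a) (hap : a.Periodic 1)
    (hf : Continuous f) (hfp : f.Periodic 1) (hne : ∫ x in (0 : ℝ)..1, a x ≠ 0) :
    ∃ h : ℝ → ℝ, h.Periodic 1 ∧ ∀ x, HasDerivAt h (f x - a x * h x) x := by
  set A : ℝ → ℝ := fun x => ∫ t in (0 : ℝ)..x, a t with hA
  have hAd : ∀ x, HasDerivAt A (a x) x := fun x =>
    (ha.integral_hasStrictDerivAt 0 x).hasDerivAt
  have hAc : Continuous A := continuous_iff_continuousAt.2 fun x => (hAd x).continuousAt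
  have hg : Continuous fun t => Real.exp (A t) * f t := (Real.continuous_exp.comp hAc).mul hf
  set G : ℝ → ℝ := fun x => ∫ t in (0 : ℝ)..x, Real.exp (A t) * f t with hG
  have hGd : ∀ x, HasDerivAt G (Real.exp (A x) * f x) x := fun x =>
    (hg.integral_hasStrictDerivAt 0 x).hasDerivAt
  have hE : Real.exp (A 1) - 1 ≠ 0 := fun h => hne (Real.exp_eq_one_iff _ |>.1 (by linarith))
  -- The initial value forced by `h 1 = h 0`; the mean of `a` being nonzero makes the denominator
  -- nonzero.
  set c : ℝ := G 1 / (Real.exp (A 1) - 1) with hc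
  set h : ℝ → ℝ := fun x => Real.exp (-A x) * (c + G x) with hh
  have hhd : ∀ x, HasDerivAt h (f x - a x * h x) x := fun x => by
    have h1 := ((hAd x).neg.exp).mul ((hGd x).const_add c)
    refine h1.congr_deriv ?_
    simp only [hh, Pi.neg_apply]
    have : Real.exp (-A x) * Real.exp (A x) = 1 := by rw [← Real.exp_add]; simp
    linear_combination f x * this
  refine ⟨h, fun x => ?_, hhd⟩
  -- `h (x + 1) - h x` solves the homogeneous equation, so it vanishes everywhere once it vanishes
  -- at `0`.
  have hd : ∀ x, HasDerivAt (fun x => Real.exp (A x) * (h (x + 1) - h x)) 0 x := fun x => by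
    have h2 : HasDerivAt (fun x => h (x + 1)) (f x - a x * h (x + 1)) x := by
      have := (hhd (x + 1)).comp_add_const x 1
      rwa [hfp x, hap x] at this
    refine ((hAd x).exp.mul (h2.sub (hhd x))).congr_deriv ?_
    simp only [Pi.sub_apply]
    ring
  have hconst := is_const_of_deriv_eq_zero (fun x => (hd x).differentiableAt)
    (fun x => (hd x).deriv) x 0
  have h0 : h 1 = h 0 := by
    simp only [hh, hA, hG, intervalIntegral.integral_same, neg_zero, Real.exp_zero]
    change Real.exp (-A 1) * (c + G 1) = 1 * (c + 0)
    have h1 : c * (Real.exp (A 1) - 1) = G 1 := div_mul_cancel₀ _ hE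
    have h2 : Real.exp (-A 1) * Real.exp (A 1) = 1 := by rw [← Real.exp_add]; simp
    linear_combination -Real.exp (-A 1) * h1 + c * h2
  simp only [zero_add, h0, sub_self, mul_zero] at hconst
  have := (mul_eq_zero.1 hconst).resolve_left (Real.exp_pos _).ne'
  linarith

/-- The function `exp (k x) d x` is monotone, and one period multiplies it by `exp k > 1`, which is
impossible where `d` is negative. -/
lemma nonneg_of_periodic_of_deriv {k : ℝ} (hk : 0 < k) {d d' : ℝ → ℝ} (hp : d.Periodic 1)
    (hd : ∀ x, HasDerivAt d (d' x) x) (h : ∀ x, 0 ≤ d' x + k * d x) (x : ℝ) : 0 ≤ d x := by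
  have h1 : ∀ x, HasDerivAt (fun x => Real.exp (k * x) * d x)
      (Real.exp (k * x) * (d' x + k * d x)) x := fun x => by
    refine ((((hasDerivAt_id x).const_mul k).exp).mul (hd x)).congr_deriv ?_
    simp only [id]
    ring
  have hm := monotone_of_hasDerivAt_nonneg h1 fun x => mul_nonneg (Real.exp_pos _).le (h x)
  have h2 := hm (show x ≤ x + 1 by linarith)
  simp only [hp x] at h2
  have h3 : Real.exp (k * x) < Real.exp (k * (x + 1)) := Real.exp_lt_exp.2 (by linarith)
  by_contra! h4
  nlinarith

/-! ### Periodic solutions and subsolutions of the Riccati equation -/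

/-- `p` is a periodic solution on `ℝ` of `p' = Q - μ - p²`. -/
def IsRiccati (Q : ℝ → ℝ) (μ : ℝ) (p : ℝ → ℝ) : Prop :=
  p.Periodic 1 ∧ ∀ x, HasDerivAt p (Q x - μ - p x ^ 2) x

/-- `p` is a periodic subsolution on `ℝ` of `p' = Q - μ - p²`. -/
def IsSubRiccati (Q : ℝ → ℝ) (μ : ℝ) (p : ℝ → ℝ) : Prop :=
  ContDiff ℝ 1 p ∧ p.Periodic 1 ∧ ∀ x, deriv p x + p x ^ 2 + μ ≤ Q x

lemma IsRiccati.continuous {Q : ℝ → ℝ} {μ : ℝ} {p : ℝ → ℝ} (h : IsRiccati Q μ p) :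
    Continuous p := continuous_iff_continuousAt.2 fun x => (h.2 x).continuousAt

lemma IsRiccati.contDiff {Q : ℝ → ℝ} {μ : ℝ} {p : ℝ → ℝ} (hQ : Continuous Q)
    (h : IsRiccati Q μ p) : ContDiff ℝ 1 p := by
  rw [contDiff_one_iff_deriv]
  refine ⟨fun x => (h.2 x).differentiableAt, ?_⟩
  rw [funext fun x => (h.2 x).deriv]
  exact (hQ.sub continuous_const).sub (h.continuous.pow 2)

lemma IsRiccati.isSub {Q : ℝ → ℝ} {μ ν : ℝ} {p : ℝ → ℝ} (hQ : Continuous Q)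
    (h : IsRiccati Q μ p) (hν : ν ≤ μ) : IsSubRiccati Q ν p :=
  ⟨h.contDiff hQ, h.1, fun x => by rw [(h.2 x).deriv]; linarith⟩

/-- At the maximum and the minimum of `p` the derivative vanishes, leaving `p² ≤ Q - μ`. -/
lemma IsSubRiccati.abs_apply_le {Q : ℝ → ℝ} {μ M : ℝ} {p : ℝ → ℝ} (h : IsSubRiccati Q μ p)
    (hM : 0 < M) (hQM : ∀ x, Q x - μ ≤ M ^ 2) (x : ℝ) : |p x| ≤ M := by
  obtain ⟨hc, hp, hle⟩ := h
  obtain ⟨y, hy⟩ := exists_forall_le_of_periodic hc.continuous hp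
  obtain ⟨z, hz⟩ := exists_forall_le_of_periodic hc.continuous.neg (f := fun x => -p x)
    fun x => by simp only [hp x]
  have h1 : deriv p y = 0 := IsLocalMax.deriv_eq_zero (Eventually.of_forall hy)
  have h2 : deriv p z = 0 :=
    IsLocalMin.deriv_eq_zero (Eventually.of_forall fun x => neg_le_neg_iff.1 (hz x))
  have h3 := hle y
  have h4 := hle z
  have h5 := abs_le_of_sq_le_sq' (show p y ^ 2 ≤ M ^ 2 by linarith [hQM y]) hM.le
  have h6 := abs_le_of_sq_le_sq' (show p z ^ 2 ≤ M ^ 2 by linarith [hQM z]) hM.le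
  exact abs_le.2 ⟨by linarith [hz x], by linarith [hy x]⟩

/-- Pointwise limits pass through the integrated equation by dominated convergence. The uniform
bound on the derivatives makes the limit Lipschitz, hence continuous, so the integrated equation can
be differentiated again. -/
lemma isRiccati_of_tendsto {Q : ℝ → ℝ} {μ C : ℝ} {u F : ℕ → ℝ → ℝ} {P : ℝ → ℝ}
    (hQ : Continuous Q)
    (hup : ∀ n, (u n).Periodic 1) (hud : ∀ n x, HasDerivAt (u n) (F n x) x)
    (hFc : ∀ n, Continuous (F n)) (hFC : ∀ n x, |F n x| ≤ C)
    (hu : ∀ x, Tendsto (fun n => u n x) atTop (𝓝 (P x)))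
    (hF : ∀ x, Tendsto (fun n => F n x) atTop (𝓝 (Q x - μ - P x ^ 2))) : IsRiccati Q μ P := by
  have hint : ∀ n x, ∫ t in (0 : ℝ)..x, F n t = u n x - u n 0 := fun n x =>
    intervalIntegral.integral_eq_sub_of_hasDerivAt (fun t _ => hud n t)
      ((hFc n).intervalIntegrable _ _)
  have hlim : ∀ x, ∫ t in (0 : ℝ)..x, (Q t - μ - P t ^ 2) = P x - P 0 := fun x => by
    refine tendsto_nhds_unique ?_ ((hu x).sub (hu 0))
    simp_rw [← hint]
    refine intervalIntegral.tendsto_integral_filter_of_dominated_convergence (fun _ => C)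
      (Eventually.of_forall fun n => (hFc n).aestronglyMeasurable)
      (Eventually.of_forall fun n => Eventually.of_forall fun t _ => hFC n t)
      (intervalIntegrable_const) (Eventually.of_forall fun t _ => hF t)
  have hlip : LipschitzWith (Real.toNNReal C) P := by
    refine LipschitzWith.of_dist_le_mul fun x y => ?_
    refine le_of_tendsto ((hu x).dist (hu y)) (Eventually.of_forall fun n => ?_)
    refine LipschitzWith.dist_le_mul (lipschitzWith_of_nnnorm_deriv_le
      (fun x => (hud n x).differentiableAt) fun x => ?_) x y
    rw [(hud n x).deriv, ← NNReal.coe_le_coe, coe_nnnorm]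
    exact (hFC n x).trans (Real.le_coe_toNNReal C)
  have hPc := hlip.continuous
  refine ⟨fun x => tendsto_nhds_unique (hu (x + 1)) (by simpa only [hup _ x] using hu x),
    fun x => ?_⟩
  have hc : Continuous fun t => Q t - μ - P t ^ 2 :=
    (hQ.sub continuous_const).sub (hPc.pow 2)
  have := ((hc.integral_hasStrictDerivAt 0 x).hasDerivAt).add_const (P 0)
  refine this.congr_of_eventuallyEq (Eventually.of_forall fun y => ?_)
  simp only [hlim y]
  ring

/-- Monotone iteration from the constant `M`: each step solves `v' + k v = k u + (Q - μ) - u²`. With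
`k = 2M` the map `u ↦ k u - u²` is increasing below `M`, so by comparison the iterates decrease and
stay above every subsolution; their limit is the maximal solution. -/
lemma IsSubRiccati.exists_maximal {Q : ℝ → ℝ} {μ : ℝ} {p : ℝ → ℝ} (hQ : Continuous Q)
    (hQp : Q.Periodic 1) (h : IsSubRiccati Q μ p) :
    ∃ P, IsRiccati Q μ P ∧ ∀ r, IsSubRiccati Q μ r → ∀ x, r x ≤ P x := by
  obtain ⟨B, hB, hQB⟩ := exists_abs_le_of_periodic (hQ.sub continuous_const)
    (f := fun x => Q x - μ) (fun x => by simp only [hQp x])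
  obtain ⟨M, hM, hM1, hBM⟩ : ∃ M : ℝ, 0 < M ∧ 1 ≤ M ∧ B ≤ M ^ 2 :=
    ⟨B + 1, by linarith, by linarith, by nlinarith⟩
  have hQM : ∀ x, Q x - μ ≤ M ^ 2 := fun x => ((le_abs_self _).trans (hQB x)).trans hBM
  set k : ℝ := 2 * M with hk
  have hk0 : 0 < k := by positivity
  have step : ∀ u : {u : ℝ → ℝ // Continuous u ∧ u.Periodic 1},
      ∃ v : {u : ℝ → ℝ // Continuous u ∧ u.Periodic 1},
        ∀ x, HasDerivAt v.1 (k * u.1 x + (Q x - μ) - u.1 x ^ 2 - k * v.1 x) x := fun u => by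
    obtain ⟨v, hv, hvd⟩ := exists_periodic_linear (a := fun _ => k)
      (f := fun x => k * u.1 x + (Q x - μ) - u.1 x ^ 2) continuous_const (fun _ => rfl)
      (((continuous_const.mul u.2.1).add (hQ.sub continuous_const)).sub (u.2.1.pow 2))
      (fun x => by simp only [u.2.2 x, hQp x]) (by simpa using hk0.ne')
    exact ⟨⟨v, continuous_iff_continuousAt.2 fun x => (hvd x).continuousAt, hv⟩, hvd⟩
  choose T hT using step
  let u : ℕ → {u : ℝ → ℝ // Continuous u ∧ u.Periodic 1} :=
    fun n => T^[n] ⟨fun _ => M, continuous_const, fun _ => rfl⟩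
  have hus : ∀ n, u (n + 1) = T (u n) := fun n => Function.iterate_succ_apply' _ _ _
  have hlow : ∀ r, IsSubRiccati Q μ r → ∀ v : {u : ℝ → ℝ // Continuous u ∧ u.Periodic 1},
      (∀ x, r x ≤ v.1 x) → (∀ x, v.1 x ≤ M) → ∀ x, r x ≤ (T v).1 x := fun r hr v h1 h2 x => by
    have := nonneg_of_periodic_of_deriv hk0 (d := fun x => (T v).1 x - r x)
      (fun x => by simp only [(T v).2.2 x, hr.2.1 x])
      (fun x => (hT v x).sub ((hr.1.differentiable one_ne_zero x).hasDerivAt)) (fun x => ?_) x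
    · linarith
    · have h3 := hr.2.2 x
      have h4 := abs_le.1 (hr.abs_apply_le hM hQM x)
      -- The quantity to bound below is at least `(v - r)(k - v - r)`, and `v, r ≤ M = k / 2`.
      nlinarith [h1 x, h2 x, mul_nonneg (sub_nonneg.2 (h1 x))
        (show 0 ≤ k - (v.1 x + r x) by linarith [h1 x, h2 x])]
  have hbd : ∀ n x, (u n).1 x ≤ M ∧ ∀ r, IsSubRiccati Q μ r → ∀ x, r x ≤ (u n).1 x := by
    intro n
    induction n with
    | zero => exact fun x => ⟨le_rfl, fun r hr x => (abs_le.1 (hr.abs_apply_le hM hQM x)).2⟩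
    | succ n ih =>
      rw [hus]
      refine fun x => ⟨?_, fun r hr => hlow r hr _ ((ih x).2 r hr) fun x => (ih x).1⟩
      have := nonneg_of_periodic_of_deriv hk0 (d := fun x => M - (T (u n)).1 x)
        (fun x => by simp only [(T (u n)).2.2 x])
        (fun x => (hT (u n) x).const_sub M) (fun x => ?_) x
      · linarith
      -- The quantity equals `(M - u)² + M² - (Q - μ)`.
      · nlinarith [hQM x, (ih x).1, sq_nonneg (M - (u n).1 x)]
  have habs : ∀ n x, |(u n).1 x| ≤ M := fun n x => abs_le.2
    ⟨(abs_le.1 (h.abs_apply_le hM hQM x)).1.trans ((hbd n x).2 p h x), (hbd n x).1⟩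
  have hanti : ∀ n x, (u (n + 1)).1 x ≤ (u n).1 x := by
    intro n
    induction n with
    | zero => exact fun x => (hbd 1 x).1
    | succ n ih =>
      intro x
      rw [hus (n + 1), hus n, ← hus n]
      have := nonneg_of_periodic_of_deriv hk0
        (d := fun x => (T (u n)).1 x - (T (u (n + 1))).1 x)
        (fun x => by simp only [(T (u n)).2.2 x, (T (u (n + 1))).2.2 x])
        (fun x => (hT (u n) x).sub (hT (u (n + 1)) x)) (fun x => ?_) x
      · rw [← hus n] at this
        linarith
      · nlinarith [mul_nonneg (sub_nonneg.2 (ih x))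
          (show 0 ≤ k - ((u n).1 x + (u (n + 1)).1 x) by
            linarith [(hbd n x).1, (hbd (n + 1) x).1])]
  have hlim : ∀ x, Tendsto (fun n => (u n).1 x) atTop (𝓝 (⨅ n, (u n).1 x)) := fun x =>
    tendsto_atTop_ciInf (antitone_nat_of_succ_le fun n => hanti n x)
      ⟨-M, by rintro _ ⟨n, rfl⟩; exact (abs_le.1 (habs n x)).1⟩
  refine ⟨fun x => ⨅ n, (u n).1 x, ?_, fun r hr x => ge_of_tendsto' (hlim x)
    fun n => (hbd n x).2 r hr x⟩
  refine isRiccati_of_tendsto (u := fun n => (u (n + 1)).1) (C := k * M + B + M ^ 2 + k * M)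
    (F := fun n x => k * (u n).1 x + (Q x - μ) - (u n).1 x ^ 2 - k * (u (n + 1)).1 x) hQ
    (fun n => (u (n + 1)).2.2) (fun n x => by simpa only [hus] using hT (u n) x)
    (fun n => (((continuous_const.mul (u n).2.1).add (hQ.sub continuous_const)).sub
      ((u n).2.1.pow 2)).sub (continuous_const.mul (u (n + 1)).2.1))
    (fun n x => ?_) (fun x => (tendsto_add_atTop_iff_nat 1).2 (hlim x)) (fun x => ?_)
  · have h1 := abs_le.1 (habs n x)
    have h2 := abs_le.1 (habs (n + 1) x)
    have h3 := abs_le.1 (hQB x)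
    have h4 : (u n).1 x ^ 2 ≤ M ^ 2 := sq_le_sq' h1.1 h1.2
    exact abs_le.2 ⟨by nlinarith, by nlinarith [sq_nonneg ((u n).1 x)]⟩
  · have := ((((hlim x).const_mul k).add_const (Q x - μ)).sub ((hlim x).pow 2)).sub
      (((tendsto_add_atTop_iff_nat 1).2 (hlim x)).const_mul k)
    convert this using 2
    ring

/-- For some value of the spectral parameter there is a periodic solution with mean zero. -/
theorem exists_isRiccati_integral_eq_zero {Q : ℝ → ℝ} (hQ : Continuous Q) (hQp : Q.Periodic 1) :
    ∃ μ P, IsRiccati Q μ P ∧ ∫ x in (0 : ℝ)..1, P x = 0 := by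
  obtain ⟨B, hB, hQB⟩ := exists_abs_le_of_periodic hQ hQp
  set S : Set ℝ := {μ | ∃ p, IsSubRiccati Q μ p} with hS
  have hne : S.Nonempty := ⟨-B, fun _ => 0, contDiff_const, fun _ => rfl, fun x => by
    simpa using (abs_le.1 (hQB x)).1⟩
  have hbdd : BddAbove S := by
    refine ⟨B, ?_⟩
    rintro μ ⟨p, hc, hp, hle⟩
    obtain ⟨y, hy⟩ := exists_forall_le_of_periodic hc.continuous hp
    have h1 : deriv p y = 0 := IsLocalMax.deriv_eq_zero (Eventually.of_forall hy)
    have := hle y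
    nlinarith [(abs_le.1 (hQB y)).2, sq_nonneg (p y)]
  obtain ⟨m, hm, hmlim, hmS⟩ := exists_seq_tendsto_sSup hne hbdd
  have hex : ∀ n, ∃ P, IsRiccati Q (m n) P ∧ ∀ r, IsSubRiccati Q (m n) r → ∀ x, r x ≤ P x :=
    fun n => (hmS n).choose_spec.exists_maximal hQ hQp
  choose P hP hmax using hex
  obtain ⟨M, hM, hQM⟩ : ∃ M : ℝ, 0 < M ∧ ∀ n x, Q x - m n ≤ M ^ 2 := by
    refine ⟨B + |m 0| + 1, by positivity, fun n x => ?_⟩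
    have h1 := (abs_le.1 (hQB x)).2
    have h2 := hm (Nat.zero_le n)
    have h3 := neg_abs_le (m 0)
    nlinarith [abs_nonneg (m 0)]
  have habs : ∀ n x, |P n x| ≤ M := fun n x => ((hP n).isSub hQ le_rfl).abs_apply_le hM (hQM n) x
  -- A solution at a higher level is a subsolution at a lower one, so the maximal solutions decrease
  -- as the levels `m n` increase.
  have hlim : ∀ x, Tendsto (fun n => P n x) atTop (𝓝 (⨅ n, P n x)) := fun x =>
    tendsto_atTop_ciInf (antitone_nat_of_succ_le fun n =>
      hmax n _ ((hP (n + 1)).isSub hQ (hm n.le_succ)) x)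
      ⟨-M, by rintro _ ⟨n, rfl⟩; exact (abs_le.1 (habs n x)).1⟩
  set R : ℝ → ℝ := fun x => ⨅ n, P n x with hR
  have hRic : IsRiccati Q (sSup S) R := by
    refine isRiccati_of_tendsto (u := P) (C := B + (B + |m 0|) + M ^ 2)
      (F := fun n x => Q x - m n - P n x ^ 2) hQ (fun n => (hP n).1) (fun n => (hP n).2)
      (fun n => (hQ.sub continuous_const).sub ((hP n).continuous.pow 2)) (fun n x => ?_) hlim
      fun x => (hmlim.const_sub (Q x)).sub ((hlim x).pow 2)
    have h1 := abs_le.1 (hQB x)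
    have h2 := hm (Nat.zero_le n)
    have h3 := neg_abs_le (m 0)
    have h4 := abs_le.1 (habs n x)
    have h5 : P n x ^ 2 ≤ M ^ 2 := sq_le_sq' h4.1 h4.2
    have h6 : m n ≤ B := by
      obtain ⟨y, hy⟩ := exists_forall_le_of_periodic (hP n).continuous (hP n).1
      have h1 : Q y - m n - P n y ^ 2 = 0 :=
        IsLocalMax.hasDerivAt_eq_zero (Eventually.of_forall hy) ((hP n).2 y)
      nlinarith [(abs_le.1 (hQB y)).2, sq_nonneg (P n y)]
    exact abs_le.2 ⟨by nlinarith [abs_nonneg (m 0)], by nlinarith [sq_nonneg (P n x)]⟩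
  refine ⟨sSup S, R, hRic, ?_⟩
  by_contra hint
  have hRc := hRic.continuous
  -- Linearization at `R`: if its mean is nonzero, `h' + 2 R h = -1` has a periodic solution, and
  -- moving from `R` to `R + δ h` lowers the left side of the Riccati equation to first order in
  -- `δ`. This leaves room to raise the level above the supremum.
  obtain ⟨h, hhp, hhd⟩ := exists_periodic_linear (a := fun x => 2 * R x) (f := fun _ => -1)
    (continuous_const.mul hRc) (fun x => by simp only [hRic.1 x]) continuous_const
    (fun _ => rfl) (by simpa [intervalIntegral.integral_const_mul] using hint)
  have hhc : Continuous h := continuous_iff_continuousAt.2 fun x => (hhd x).continuousAt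
  obtain ⟨D, hD, hhD⟩ := exists_abs_le_of_periodic hhc hhp
  -- The second-order error `δ² h²` and the raise `δ²` of the level together must not exceed the
  -- gain `δ`.
  set δ : ℝ := 1 / (D ^ 2 + 1) with hδ
  have hδ0 : 0 < δ := by positivity
  have hδD : δ * (D ^ 2 + 1) = 1 := by rw [hδ]; field_simp
  have hder : ∀ x, HasDerivAt (fun x => R x + δ * h x)
      (Q x - sSup S - R x ^ 2 + δ * (-1 - 2 * R x * h x)) x := fun x =>
    (hRic.2 x).add ((hhd x).const_mul δ)
  have hmem : sSup S + δ * δ ∈ S := by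
    refine ⟨fun x => R x + δ * h x, ?_, fun x => by simp only [hRic.1 x, hhp x], fun x => ?_⟩
    · rw [contDiff_one_iff_deriv]
      refine ⟨fun x => (hder x).differentiableAt, ?_⟩
      rw [funext fun x => (hder x).deriv]
      fun_prop
    · rw [(hder x).deriv]
      have h1 := abs_le.1 (hhD x)
      have h2 : h x ^ 2 ≤ D ^ 2 := sq_le_sq' h1.1 h1.2
      have h3 : δ ^ 2 * h x ^ 2 ≤ δ ^ 2 * D ^ 2 := by gcongr
      have h4 : δ ^ 2 * D ^ 2 = δ - δ * δ := by linear_combination δ * hδD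
      nlinarith
  have := le_csSup hbdd hmem
  nlinarith

/-! ### Picone's identity and the bottom of the spectrum -/

/-- Picone's identity, integrated over a period. -/
lemma IsSubRiccati.integral_sq_le {Q : ℝ → ℝ} {ν l : ℝ} {p φ : ℝ → ℝ}
    (hp : IsSubRiccati Q ν p) (hφ : ContDiff ℝ 2 φ) (hφp : φ.Periodic 1)
    (heq : ∀ x, -deriv (deriv φ) x + Q x * φ x = l * φ x) :
    ∫ x in (0 : ℝ)..1, (deriv φ x - p x * φ x) ^ 2 ≤ (l - ν) * ∫ x in (0 : ℝ)..1, φ x ^ 2 := by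
  obtain ⟨hpc, hpp, hle⟩ := hp
  have hφ1 : ContDiff ℝ 1 (deriv φ) := (contDiff_succ_iff_deriv (n := 1)).1 hφ |>.2.2
  have hφc := hφ.continuous
  have hφ'c := hφ1.continuous
  have hφ''c : Continuous (deriv (deriv φ)) := (contDiff_one_iff_deriv.1 hφ1).2
  have hp'c : Continuous (deriv p) := (contDiff_one_iff_deriv.1 hpc).2
  have hpc' := hpc.continuous
  have hd1 : ∀ x, HasDerivAt φ (deriv φ x) x := fun x =>
    (hφ.differentiable two_ne_zero x).hasDerivAt
  have hd2 : ∀ x, HasDerivAt (deriv φ) (deriv (deriv φ) x) x := fun x =>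
    (hφ1.differentiable one_ne_zero x).hasDerivAt
  have hd3 : ∀ x, HasDerivAt p (deriv p x) x := fun x =>
    (hpc.differentiable one_ne_zero x).hasDerivAt
  have hφ'p : (deriv φ).Periodic 1 := fun x => by
    rw [← deriv_comp_add_const, funext hφp]
  set W' : ℝ → ℝ := fun x => deriv φ x * deriv φ x + φ x * deriv (deriv φ) x -
    (deriv p x * φ x ^ 2 + p x * (2 * φ x * deriv φ x)) with hW'
  have hW : ∀ x, HasDerivAt (fun x => φ x * deriv φ x - p x * φ x ^ 2) (W' x) x := fun x => by
    refine (((hd1 x).mul (hd2 x)).sub ((hd3 x).mul ((hd1 x).pow 2))).congr_deriv ?_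
    simp only [hW']
    simp
  have hW'c : Continuous W' := by fun_prop
  have hint : ∫ x in (0 : ℝ)..1, W' x = 0 := by
    rw [intervalIntegral.integral_eq_sub_of_hasDerivAt (fun x _ => hW x)
      (hW'c.intervalIntegrable _ _)]
    have h1 := hφp 0
    have h2 := hφ'p 0
    have h3 := hpp 0
    simp only [zero_add] at h1 h2 h3
    rw [h1, h2, h3, sub_self]
  have hsub : ∫ x in (0 : ℝ)..1, (deriv φ x - p x * φ x) ^ 2 =
      ∫ x in (0 : ℝ)..1, ((deriv φ x - p x * φ x) ^ 2 - W' x) := by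
    rw [intervalIntegral.integral_sub (Continuous.intervalIntegrable (by fun_prop) _ _)
      (hW'c.intervalIntegrable _ _), hint, sub_zero]
  rw [← intervalIntegral.integral_const_mul, hsub]
  refine intervalIntegral.integral_mono_on zero_le_one
    (Continuous.intervalIntegrable (by fun_prop) _ _)
    (Continuous.intervalIntegrable (by fun_prop) _ _) fun x _ => ?_
  -- The integrand minus `W'` is `(p' + p²) φ² - φ φ''`; the subsolution inequality bounds the first
  -- term and the eigenvalue equation rewrites the second.
  have h1 := mul_le_mul_of_nonneg_right (hle x) (sq_nonneg (φ x))
  have h2 : φ x * deriv (deriv φ) x = (Q x - l) * φ x ^ 2 := by linear_combination -φ x * heq x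
  simp only [hW']
  nlinarith

lemma integral_sq_pos {φ : ℝ → ℝ} (hφ : Continuous φ) (hφp : φ.Periodic 1) {x : ℝ}
    (hx : φ x ≠ 0) : 0 < ∫ x in (0 : ℝ)..1, φ x ^ 2 := by
  obtain ⟨y, hy, hxy⟩ := hφp.exists_mem_Ico₀ one_pos x
  refine intervalIntegral.integral_pos one_pos (hφ.pow 2).continuousOn (fun _ _ => sq_nonneg _)
    ⟨y, ⟨hy.1, hy.2.le⟩, ?_⟩
  rw [hxy] at hx
  positivity

section Eigenvalues

variable {q : UnitAddCircle → ℝ}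

lemma continuous_lift (hq : Continuous q) : Continuous fun x : ℝ => q x :=
  hq.comp (AddCircle.continuous_mk' 1)

lemma periodic_lift : Function.Periodic (fun x : ℝ => q x) 1 := fun x => by
  simp only [AddCircle.coe_add_period]

lemma isRiccatiSolution_iff (hq : Continuous q) {μ : ℝ} {p : ℝ → ℝ} :
    IsRiccatiSolution q μ p ↔ IsRiccati (fun x : ℝ => q x) μ p := by
  refine ⟨fun h => ⟨h.periodic, fun x => ?_⟩, fun h => ⟨h.contDiff (continuous_lift hq), h.1,
    fun x => ?_⟩⟩
  · refine (h.contDiff.differentiable one_ne_zero x).hasDerivAt.congr_deriv ?_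
    simp only [h.eqn x]
    ring
  · rw [(h.2 x).deriv]
    ring

/-- A subsolution of the Riccati equation bounds the spectrum from below. -/
lemma IsSubRiccati.le_of_mem_eigenvalues {ν l : ℝ} {p : ℝ → ℝ}
    (hp : IsSubRiccati (fun x : ℝ => q x) ν p) (hl : l ∈ eigenvalues q) : ν ≤ l := by
  obtain ⟨φ, hφ⟩ := hl
  have h1 := hp.integral_sq_le hφ.contDiff hφ.periodic hφ.eqn
  obtain ⟨x, hx⟩ := Function.ne_iff.1 hφ.ne_zero
  have h2 := integral_sq_pos hφ.contDiff.continuous hφ.periodic hx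
  have h3 : 0 ≤ ∫ x in (0 : ℝ)..1, (deriv φ x - p x * φ x) ^ 2 :=
    intervalIntegral.integral_nonneg zero_le_one fun _ _ => sq_nonneg _
  by_contra! h4
  nlinarith

/-- The eigenfunction `exp (∫ p)` of a Riccati solution with zero log-multiplier. -/
lemma IsRiccatiSolution.exists_isEigenfunction {μ : ℝ} {p : ℝ → ℝ}
    (hp : IsRiccatiSolution q μ p) (h0 : logMultiplier p = 0) :
    ∃ ψ, IsEigenfunction q μ ψ ∧ (∀ x, 0 < ψ x) ∧ ∀ x, deriv ψ x = p x * ψ x := by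
  have hpc := hp.contDiff.continuous
  have hA : ∀ x, HasDerivAt (fun x => ∫ t in (0 : ℝ)..x, p t) (p x) x := fun x =>
    (hpc.integral_hasStrictDerivAt 0 x).hasDerivAt
  set ψ : ℝ → ℝ := fun x => Real.exp (∫ t in (0 : ℝ)..x, p t) with hψ
  have hψd : ∀ x, HasDerivAt ψ (p x * ψ x) x := fun x =>
    (hA x).exp.congr_deriv (mul_comm _ _)
  have hpd : ∀ x, HasDerivAt p (deriv p x) x := fun x =>
    (hp.contDiff.differentiable one_ne_zero x).hasDerivAt
  have hψ' : deriv ψ = fun x => p x * ψ x := funext fun x => (hψd x).deriv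
  have hψ1 : ContDiff ℝ 1 ψ := by
    rw [contDiff_one_iff_deriv, hψ']
    have hd : Differentiable ℝ ψ := fun x => (hψd x).differentiableAt
    exact ⟨hd, hpc.mul hd.continuous⟩
  refine ⟨ψ, ⟨?_, fun x => ?_, fun h => ?_, fun x => ?_⟩, fun x => Real.exp_pos _,
    fun x => (hψd x).deriv⟩
  · rw [show (2 : WithTop ℕ∞) = 1 + 1 by norm_num, contDiff_succ_iff_deriv, hψ']
    exact ⟨hψ1.differentiable one_ne_zero, by simp, hp.contDiff.mul hψ1⟩
  · simp only [hψ]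
    rw [hp.periodic.intervalIntegral_add_eq_add 0 x (fun _ _ => hpc.intervalIntegrable _ _),
      zero_add, show ∫ x in (0 : ℝ)..1, p x = 0 from h0, add_zero]
  · exact (Real.exp_pos _).ne' (congrFun h 0)
  · rw [hψ', (show HasDerivAt (fun x => p x * ψ x) _ x from (hpd x).mul (hψd x)).deriv, hp.eqn x]
    ring

lemma IsRiccatiSolution.isSub (hq : Continuous q) {μ : ℝ} {p : ℝ → ℝ}
    (hp : IsRiccatiSolution q μ p) : IsSubRiccati (fun x : ℝ => q x) μ p :=
  ((isRiccatiSolution_iff hq).1 hp).isSub (continuous_lift hq) le_rfl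

lemma IsRiccatiSolution.isLeast (hq : Continuous q) {μ : ℝ} {p : ℝ → ℝ}
    (hp : IsRiccatiSolution q μ p) (h0 : logMultiplier p = 0) : IsLeast (eigenvalues q) μ :=
  ⟨(hp.exists_isEigenfunction h0).imp fun _ h => h.1,
    fun _ hl => (hp.isSub hq).le_of_mem_eigenvalues hl⟩

lemma IsRiccatiSolution.groundState_eq (hq : Continuous q) {μ : ℝ} {p : ℝ → ℝ}
    (hp : IsRiccatiSolution q μ p) (h0 : logMultiplier p = 0) : groundState q = μ :=
  (hp.isLeast hq h0).csInf_eq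

lemma exists_isRiccatiSolution (hq : Continuous q) :
    ∃ p, IsRiccatiSolution q (groundState q) p ∧ logMultiplier p = 0 := by
  obtain ⟨μ, p, hp, h0⟩ := exists_isRiccati_integral_eq_zero (continuous_lift hq) periodic_lift
  have hp' := (isRiccatiSolution_iff hq).2 hp
  exact ⟨p, by rwa [hp'.groundState_eq hq h0], h0⟩

theorem isLeast_groundState (hq : Continuous q) : IsLeast (eigenvalues q) (groundState q) := by
  obtain ⟨p, hp, h0⟩ := exists_isRiccatiSolution hq
  exact hp.isLeast hq h0

/-- Two such solutions `p`, `r` share the level `groundState q`. Picone's inequality for `p` and the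
eigenfunction `ψ` built from `r` has right side zero, so `ψ' = p ψ`, while `ψ' = r ψ` and `ψ > 0`.
-/
theorem existsUnique_isZeroMultiplierSolution (hq : Continuous q) :
    ∃! p : ℝ → ℝ, IsZeroMultiplierSolution q p := by
  obtain ⟨p, hp, h0⟩ := exists_isRiccatiSolution hq
  refine ⟨p, ⟨⟨_, hp⟩, h0⟩, ?_⟩
  rintro r ⟨⟨ν, hr⟩, hr0⟩
  rw [← hr.groundState_eq hq hr0] at hr
  obtain ⟨ψ, hψ, hpos, hd⟩ := hr.exists_isEigenfunction hr0
  have h1 := (hp.isSub hq).integral_sq_le hψ.contDiff hψ.periodic hψ.eqn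
  rw [sub_self, zero_mul] at h1
  funext x
  by_contra hne
  have hψ1 : ContDiff ℝ 1 (deriv ψ) := (contDiff_succ_iff_deriv (n := 1)).1 hψ.contDiff |>.2.2
  have hc : Continuous fun x => deriv ψ x - p x * ψ x :=
    hψ1.continuous.sub (hp.contDiff.continuous.mul hψ.contDiff.continuous)
  refine absurd h1 (not_le.2 (integral_sq_pos hc (x := x) (fun y => ?_) ?_))
  · simp only [hd, hr.periodic y, hp.periodic y, hψ.periodic y]
  · rw [hd, ← sub_mul]
    exact mul_ne_zero (sub_ne_zero.2 hne) (hpos x).ne'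

lemma integral_circle_eq (f : UnitAddCircle → ℝ) : ∫ x, f x = ∫ x in (0 : ℝ)..1, f x := by
  rw [← UnitAddCircle.intervalIntegral_preimage 0 f, zero_add]

/-- The ground state eigenvalue is the mean of the potential minus the energy of `p`. -/
lemma IsRiccatiSolution.eq_integral_sub {μ : ℝ} {p : ℝ → ℝ}
    (hp : IsRiccatiSolution q μ p) : μ = (∫ x, q x) - ∫ x in (0 : ℝ)..1, p x ^ 2 := by
  have hpc := hp.contDiff.continuous
  have hp'c : Continuous (deriv p) := (contDiff_one_iff_deriv.1 hp.contDiff).2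
  have h1 : ∫ x in (0 : ℝ)..1, deriv p x = 0 := by
    rw [intervalIntegral.integral_deriv_eq_sub
      (fun x _ => hp.contDiff.differentiable one_ne_zero x) (hp'c.intervalIntegrable _ _)]
    have := hp.periodic 0
    rw [zero_add] at this
    rw [this, sub_self]
  rw [integral_circle_eq]
  simp_rw [hp.eqn]
  rw [intervalIntegral.integral_add (Continuous.intervalIntegrable (by fun_prop) _ _)
    (Continuous.intervalIntegrable (by fun_prop) _ _), intervalIntegral.integral_add
    (Continuous.intervalIntegrable (by fun_prop) _ _)
    (Continuous.intervalIntegrable (by fun_prop) _ _), h1]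
  simp

end Eigenvalues

/-! ### The functional `Φ` and continuity of the ground state -/

lemma Phi_eq (g : H) {p : ℝ → ℝ} (hp : IsZeroMultiplierSolution g.1 p) :
    Phi g = ∫ x in (0 : ℝ)..1, p x ^ 2 := by
  have h : ∃ p, IsZeroMultiplierSolution g.1 p := ⟨p, hp⟩
  rw [Phi, dif_pos h,
    (existsUnique_isZeroMultiplierSolution g.1.continuous).unique h.choose_spec hp]

lemma Phi_nonneg (g : H) : 0 ≤ Phi g := by
  obtain ⟨p, hp, -⟩ := existsUnique_isZeroMultiplierSolution g.1.continuous
  rw [Phi_eq g hp]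
  exact intervalIntegral.integral_nonneg zero_le_one fun _ _ => sq_nonneg _

/-- Subtracting a constant from the potential shifts only the level, so `f` and `tilde f` have the
same `p`; in the mean of the Riccati equation the term `p'` drops out. -/
lemma groundState_eq_integral_sub_Phi (f : C(UnitAddCircle, ℝ)) :
    groundState f = (∫ x, f x) - Phi (tilde f) := by
  obtain ⟨p, hp, h0⟩ := exists_isRiccatiSolution f.continuous
  have hp' : IsZeroMultiplierSolution (tilde f).1 p :=
    ⟨⟨groundState f - ∫ x, f x, hp.contDiff, hp.periodic, fun x => by
      have := hp.eqn x
      simp only [tilde, ContinuousMap.sub_apply, ContinuousMap.const_apply]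
      linarith⟩, h0⟩
  rw [Phi_eq _ hp']
  exact hp.eq_integral_sub

/-- The Riccati solution of `f` is a subsolution for `g` once its level is lowered by the uniform
distance. -/
lemma groundState_le_add_dist (f g : C(UnitAddCircle, ℝ)) :
    groundState f ≤ groundState g + dist f g := by
  obtain ⟨p, hp, h0⟩ := exists_isRiccatiSolution f.continuous
  have hs := hp.isSub f.continuous
  have : IsSubRiccati (fun x : ℝ => g x) (groundState f - dist f g) p :=
    ⟨hs.1, hs.2.1, fun x => by
      have h1 := hs.2.2 x
      have h2 := ContinuousMap.dist_apply_le_dist (f := f) (g := g) (x : UnitAddCircle)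
      rw [Real.dist_eq] at h2
      linarith [(abs_le.1 h2).2]⟩
  linarith [this.le_of_mem_eigenvalues (isLeast_groundState g.continuous).1]

lemma continuous_groundState : Continuous fun f : C(UnitAddCircle, ℝ) => groundState f := by
  refine (LipschitzWith.of_dist_le_mul (K := 1) fun f g => ?_).continuous
  rw [NNReal.coe_one, one_mul, Real.dist_eq, abs_le]
  have h1 := groundState_le_add_dist f g
  have h2 := groundState_le_add_dist g f
  rw [dist_comm] at h2
  exact ⟨by linarith, by linarith⟩

lemma measurable_Phi : Measurable Phi := by
  -- On `H` the mean vanishes, so `Φ` inherits continuity from the ground state.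
  have h : Phi = fun g : H => -groundState g.1 := funext fun g => by
    obtain ⟨p, hp, h0⟩ := exists_isRiccatiSolution g.1.continuous
    rw [Phi_eq g ⟨⟨_, hp⟩, h0⟩]
    conv_rhs => rw [hp.eq_integral_sub, g.2]
    ring
  rw [h]
  exact (continuous_groundState.comp continuous_subtype_val).neg.measurable

/-! ### Mixtures of translated Gaussians -/

section GaussianMixture

/-- Monomials suffice: `|x|ⁿ ≤ n! exp |x|` and `|x| - x² / 2 ≤ 1 / 2`. The bound supplies the
constant domination for differentiating under the integral. -/
lemma exists_bound_polynomial_mul_gaussian (P : ℝ[X]) :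
    ∃ C, ∀ x : ℝ, |P.eval x * Real.exp (-(1 / 2) * x ^ 2)| ≤ C := by
  induction P using Polynomial.induction_on' with
  | add P Q hP hQ =>
    obtain ⟨C, hC⟩ := hP
    obtain ⟨D, hD⟩ := hQ
    refine ⟨C + D, fun x => ?_⟩
    rw [Polynomial.eval_add, add_mul]
    exact (abs_add_le _ _).trans (add_le_add (hC x) (hD x))
  | monomial n a =>
    refine ⟨|a| * (n.factorial * Real.exp (1 / 2)), fun x => ?_⟩
    rw [Polynomial.eval_monomial, mul_assoc, abs_mul]
    refine mul_le_mul_of_nonneg_left ?_ (abs_nonneg a)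
    rw [abs_mul, abs_pow, Real.abs_exp]
    have h1 : |x| ^ n ≤ n.factorial * Real.exp |x| := by
      have := Real.pow_div_factorial_le_exp |x| (abs_nonneg x) n
      rwa [div_le_iff₀' (by positivity)] at this
    calc |x| ^ n * Real.exp (-(1 / 2) * x ^ 2)
        ≤ n.factorial * Real.exp |x| * Real.exp (-(1 / 2) * x ^ 2) := by gcongr
      _ = n.factorial * Real.exp (|x| + -(1 / 2) * x ^ 2) := by rw [Real.exp_add]; ring
      _ ≤ n.factorial * Real.exp (1 / 2) := by
        gcongr
        nlinarith [sq_nonneg (|x| - 1), sq_abs x]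

variable {α : Type*} [MeasurableSpace α] {ν : Measure α} [IsProbabilityMeasure ν] {Φ : α → ℝ}

lemma integrable_polynomial_mul_gaussian (hΦ : Measurable Φ) (P : ℝ[X]) (t : ℝ) :
    Integrable (fun g => P.eval (t + Φ g) * Real.exp (-(1 / 2) * (t + Φ g) ^ 2)) ν := by
  obtain ⟨C, hC⟩ := exists_bound_polynomial_mul_gaussian P
  have hc : Continuous fun x : ℝ => P.eval x * Real.exp (-(1 / 2) * x ^ 2) := by fun_prop
  exact Integrable.of_bound (hc.measurable.comp (hΦ.const_add t)).aestronglyMeasurable C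
    (Eventually.of_forall fun g => hC _)

/-- Polynomials times the Gaussian are closed under differentiation, via `P ↦ P' - X P`; carrying a
general `P` is what lets the induction for smoothness run. -/
lemma hasDerivAt_integral_polynomial_mul_gaussian (hΦ : Measurable Φ) (P : ℝ[X]) (t : ℝ) :
    HasDerivAt (fun t => ∫ g, P.eval (t + Φ g) * Real.exp (-(1 / 2) * (t + Φ g) ^ 2) ∂ν)
      (∫ g, (P.derivative - Polynomial.X * P).eval (t + Φ g) *
        Real.exp (-(1 / 2) * (t + Φ g) ^ 2) ∂ν) t := by
  obtain ⟨C, hC⟩ := exists_bound_polynomial_mul_gaussian (P.derivative - Polynomial.X * P)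
  refine (hasDerivAt_integral_of_dominated_loc_of_deriv_le (bound := fun _ => C)
    (F := fun t g => P.eval (t + Φ g) * Real.exp (-(1 / 2) * (t + Φ g) ^ 2))
    (F' := fun t g => (P.derivative - Polynomial.X * P).eval (t + Φ g) *
        Real.exp (-(1 / 2) * (t + Φ g) ^ 2)) univ_mem
    (Eventually.of_forall fun t => (integrable_polynomial_mul_gaussian hΦ P t).1)
    (integrable_polynomial_mul_gaussian hΦ P t)
    (integrable_polynomial_mul_gaussian hΦ _ t).1
    (Eventually.of_forall fun g s _ => hC _) (integrable_const (μ := ν) C)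
    (Eventually.of_forall fun g s _ => ?_)).2
  have h1 : HasDerivAt (fun x : ℝ => P.eval x * Real.exp (-(1 / 2) * x ^ 2))
      ((P.derivative - Polynomial.X * P).eval (s + Φ g) *
        Real.exp (-(1 / 2) * (s + Φ g) ^ 2)) (s + Φ g) := by
    refine ((P.hasDerivAt _).mul
      (((hasDerivAt_pow 2 (s + Φ g)).const_mul (-(1 / 2))).exp)).congr_deriv ?_
    simp only [Polynomial.eval_sub, Polynomial.eval_mul, Polynomial.eval_X]
    push_cast
    ring
  exact h1.comp_add_const s (Φ g)

lemma contDiff_integral_gaussian (hΦ : Measurable Φ) :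
    ContDiff ℝ ((⊤ : ℕ∞) : WithTop ℕ∞)
      (fun t => ∫ g, Real.exp (-(1 / 2) * (t + Φ g) ^ 2) ∂ν) := by
  have h : ∀ (n : ℕ) (P : ℝ[X]), ContDiff ℝ n
      (fun t => ∫ g, P.eval (t + Φ g) * Real.exp (-(1 / 2) * (t + Φ g) ^ 2) ∂ν) := by
    intro n
    induction n with
    | zero =>
      exact fun P => contDiff_zero.2 (continuous_iff_continuousAt.2 fun t =>
        (hasDerivAt_integral_polynomial_mul_gaussian hΦ P t).continuousAt)
    | succ n ih =>
      intro P
      rw [Nat.cast_add, Nat.cast_one, contDiff_succ_iff_deriv]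
      refine ⟨fun t => (hasDerivAt_integral_polynomial_mul_gaussian hΦ P t).differentiableAt,
        by simp, ?_⟩
      rw [funext fun t => (hasDerivAt_integral_polynomial_mul_gaussian (ν := ν) hΦ P t).deriv]
      exact ih _
  rw [contDiff_infty]
  intro n
  simpa using h n 1

lemma integrable_gaussian (hΦ : Measurable Φ) (t : ℝ) :
    Integrable (fun g => Real.exp (-(1 / 2) * (t + Φ g) ^ 2)) ν := by
  simpa using integrable_polynomial_mul_gaussian (ν := ν) hΦ 1 t

/-- The law of `m - Φ(T)`, for `m` standard Gaussian and independent of `T`. -/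
lemma map_sub_eq_withDensity {Ω : Type*} [MeasurableSpace Ω] {Pr : Measure Ω}
    [IsProbabilityMeasure Pr] {m : Ω → ℝ} {T : Ω → α} (hm : AEMeasurable m Pr)
    (hT : AEMeasurable T Pr) (hmT : IndepFun m T Pr) (hmlaw : Pr.map m = gaussianReal 0 1)
    (hΦ : Measurable Φ) :
    Pr.map (fun ω => m ω - Φ (T ω)) = volume.withDensity fun t => ENNReal.ofReal
      (1 / Real.sqrt (2 * Real.pi) * ∫ g, Real.exp (-(1 / 2) * (t + Φ g) ^ 2) ∂(Pr.map T)) := by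
  have : IsProbabilityMeasure (Pr.map T) := Measure.isProbabilityMeasure_map hT
  have hd : Measurable fun x : ℝ × α => x.1 - Φ x.2 := by fun_prop
  have h1 : Pr.map (fun ω => m ω - Φ (T ω)) =
      ((gaussianReal 0 1).prod (Pr.map T)).map fun x => x.1 - Φ x.2 := by
    rw [← hmlaw, ← (indepFun_iff_map_prod_eq_prod_map_map hm hT).1 hmT,
      AEMeasurable.map_map_of_aemeasurable hd.aemeasurable (hm.prodMk hT)]
    rfl
  rw [h1]
  ext B hB
  rw [Measure.map_apply hd hB, Measure.prod_apply_symm (hd hB), withDensity_apply _ hB]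
  -- With `g` fixed, the shift by `Φ g` gives the Gaussian of mean `-Φ g`; Tonelli then exchanges
  -- the integrals over `g` and `t`.
  have h2 : ∀ g, gaussianReal 0 1 ((fun x => (x, g)) ⁻¹' ((fun x : ℝ × α => x.1 - Φ x.2) ⁻¹' B)) =
      ∫⁻ t in B, ENNReal.ofReal
        (1 / Real.sqrt (2 * Real.pi) * Real.exp (-(1 / 2) * (t + Φ g) ^ 2)) := fun g => by
    have h3 : (gaussianReal 0 1).map (fun x => x - Φ g) = gaussianReal (0 - Φ g) 1 :=
      gaussianReal_map_sub_const _
    have h4 : gaussianReal 0 1 ((fun x => x - Φ g) ⁻¹' B) = gaussianReal (0 - Φ g) 1 B := by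
      rw [← h3, Measure.map_apply (by fun_prop) hB]
    refine Eq.trans h4 ?_
    rw [gaussianReal_of_var_ne_zero _ one_ne_zero, withDensity_apply _ hB]
    refine lintegral_congr fun t => ?_
    rw [gaussianPDF, gaussianPDFReal]
    congr 2
    · simp
    · congr 1
      simp only [NNReal.coe_one]
      ring
  simp_rw [h2]
  rw [lintegral_lintegral_swap (by
    refine Measurable.aemeasurable ?_
    fun_prop)]
  refine lintegral_congr fun t => ?_
  rw [← integral_const_mul, ofReal_integral_eq_lintegral_ofReal
    ((integrable_gaussian hΦ t).const_mul _)
    (Eventually.of_forall fun g => by positivity)]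

end GaussianMixture

/-! ### Measurability of path-valued maps -/

section Measurability

/-- By second countability an open set is a countable union of closed balls, and by continuity
membership in a closed ball is decided by the values on a countable dense set. -/
lemma measurable_of_denseRange {Ω : Type*} [MeasurableSpace Ω] {F : Ω → C(UnitAddCircle, ℝ)}
    {d : ℕ → UnitAddCircle} (hd : DenseRange d) (hF : ∀ k, Measurable fun ω => F ω (d k)) :
    Measurable F := by
  refine measurable_of_isOpen fun U hU => ?_
  have hball : ∀ f : U, ∃ r > 0, Metric.closedBall f.1 r ⊆ U := fun f =>
    Metric.nhds_basis_closedBall.mem_iff.1 (hU.mem_nhds f.2)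
  choose r hr hrU using hball
  obtain ⟨T, hT, hTU⟩ := TopologicalSpace.isOpen_iUnion_countable
    (fun f : U => Metric.ball f.1 (r f)) fun f => Metric.isOpen_ball
  have hUeq : U = ⋃ f ∈ T, Metric.closedBall f.1 (r f) := by
    refine Subset.antisymm (fun f hf => ?_) (iUnion₂_subset fun f _ => hrU f)
    have : f ∈ ⋃ f : U, Metric.ball f.1 (r f) :=
      mem_iUnion.2 ⟨⟨f, hf⟩, Metric.mem_ball_self (hr _)⟩
    rw [← hTU] at this
    exact iUnion₂_mono (fun f _ => Metric.ball_subset_closedBall) this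
  rw [hUeq, preimage_iUnion₂]
  refine MeasurableSet.biUnion hT fun f _ => ?_
  have : F ⁻¹' Metric.closedBall f.1 (r f) = ⋂ k, {ω | dist (F ω (d k)) (f.1 (d k)) ≤ r f} := by
    ext ω
    simp only [mem_preimage, Metric.mem_closedBall, mem_iInter, mem_ofPred_eq,
      ContinuousMap.dist_le (hr f).le]
    refine ⟨fun h k => h _, fun h x => ?_⟩
    have hc : IsClosed {x | dist (F ω x) (f.1 x) ≤ r f} :=
      isClosed_le (by fun_prop) continuous_const
    exact hd.induction_on (p := fun x => dist (F ω x) (f.1 x) ≤ r f) x hc h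
  rw [this]
  exact MeasurableSet.iInter fun k => measurableSet_le ((hF k).dist measurable_const)
    measurable_const

lemma aemeasurable_of_eval {Ω : Type*} [MeasurableSpace Ω] {Pr : Measure Ω}
    {F : Ω → C(UnitAddCircle, ℝ)} (hF : ∀ x, AEMeasurable (fun ω => F ω x) Pr) :
    AEMeasurable F Pr := by
  classical
  obtain ⟨d, hd⟩ := TopologicalSpace.exists_dense_seq UnitAddCircle
  have hae : ∀ᵐ ω ∂Pr, ∀ k, F ω (d k) = (hF (d k)).mk _ ω :=
    ae_all_iff.2 fun k => (hF (d k)).ae_eq_mk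
  obtain ⟨N, hN, hNm, hN0⟩ := exists_measurable_superset_of_null (ae_iff.1 hae)
  refine ⟨N.piecewise (fun _ => 0) F, measurable_of_denseRange hd fun k => ?_, ?_⟩
  · have : (fun ω => N.piecewise (fun _ => 0) F ω (d k)) =
        N.piecewise (fun _ => 0) ((hF (d k)).mk _) := by
      funext ω
      by_cases h : ω ∈ N
      · simp [h]
      · simp only [piecewise_eq_of_notMem _ _ _ h]
        by_contra h'
        exact h (hN fun h'' => h' (h'' k))
    rw [this]
    exact Measurable.piecewise hNm measurable_const (hF (d k)).measurable_mk
  · filter_upwards [measure_eq_zero_iff_ae_notMem.1 hN0] with ω hω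
    rw [piecewise_eq_of_notMem _ _ _ hω]

lemma continuous_integral : Continuous fun f : C(UnitAddCircle, ℝ) => ∫ x, f x := by
  refine (LipschitzWith.of_dist_le_mul (K := 1) fun f g => ?_).continuous
  have hi : ∀ f : C(UnitAddCircle, ℝ), Integrable (fun x => f x) volume := fun f =>
    f.continuous.integrable_of_hasCompactSupport (HasCompactSupport.of_compactSpace _)
  rw [NNReal.coe_one, one_mul, dist_eq_norm, ← integral_sub (hi f) (hi g)]
  refine (norm_integral_le_of_norm_le_const (C := dist f g)
    (Eventually.of_forall fun x => ?_)).trans (by simp [Measure.real])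
  rw [← dist_eq_norm]
  exact ContinuousMap.dist_apply_le_dist x

lemma continuous_tilde : Continuous tilde :=
  Continuous.subtype_mk (continuous_id.sub
    (ContinuousMap.continuous_const'.comp continuous_integral)) _

end Measurability

/-! ### Limits of Gaussian variables and processes, and Riemann sums -/

section GaussianLimits

variable {Ω : Type*} [MeasurableSpace Ω] {Pr : Measure Ω} [IsProbabilityMeasure Pr]

/-- An almost sure limit of centered Gaussian variables is Gaussian. -/
lemma hasGaussianLaw_of_tendsto {Z : ℕ → Ω → ℝ} {Y : Ω → ℝ}
    (hZ : ∀ n, HasGaussianLaw (Z n) Pr) (hZ0 : ∀ n, ∫ ω, Z n ω ∂Pr = 0)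
    (hlim : ∀ᵐ ω ∂Pr, Tendsto (fun n => Z n ω) atTop (𝓝 (Y ω))) : HasGaussianLaw Y Pr := by
  have hY : AEMeasurable Y Pr :=
    aemeasurable_of_tendsto_metrizable_ae atTop (fun n => (hZ n).aemeasurable) hlim
  have : IsProbabilityMeasure (Pr.map Y) := Measure.isProbabilityMeasure_map hY
  have hchar : ∀ X : Ω → ℝ, AEMeasurable X Pr → ∀ t : ℝ,
      charFun (Pr.map X) t = ∫ ω, Complex.exp (t * X ω * Complex.I) ∂Pr := fun X hX t => by
    rw [charFun_apply_real, integral_map hX (by fun_prop)]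
  set v : ℕ → ℝ≥0 := fun n => Var[Z n; Pr].toNNReal
  have hZchar : ∀ n (t : ℝ), charFun (Pr.map (Z n)) t = (Real.exp (-(v n * t ^ 2 / 2)) : ℝ) := by
    intro n t
    rw [(hZ n).map_eq_gaussianReal, charFun_gaussianReal, hZ0 n]
    push_cast
    congr 1
    ring
  have hconv : ∀ t : ℝ, Tendsto (fun n => ((Real.exp (-(v n * t ^ 2 / 2)) : ℝ) : ℂ)) atTop
      (𝓝 (charFun (Pr.map Y) t)) := by
    intro t
    simp_rw [← hZchar, hchar _ (hZ _).aemeasurable t, hchar Y hY t]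
    refine tendsto_integral_of_dominated_convergence (fun _ => 1) (fun n => ?_)
      (integrable_const _) (fun n => Eventually.of_forall fun ω => ?_) ?_
    · have := (hZ n).aemeasurable
      refine AEMeasurable.aestronglyMeasurable ?_
      fun_prop
    · rw [← Complex.ofReal_mul, Complex.norm_exp_ofReal_mul_I]
    · filter_upwards [hlim] with ω hω
      have hc : Continuous fun x : ℝ => Complex.exp (t * x * Complex.I) := by fun_prop
      exact (hc.tendsto _).comp hω
  -- At one such `t` the logarithm of `exp (-v t² / 2)` can be taken in the limit, so the variances
  -- converge.
  obtain ⟨t, ht, htne⟩ : ∃ t : ℝ, t ≠ 0 ∧ charFun (Pr.map Y) t ≠ 0 := by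
    have h1 : ∀ᶠ t in 𝓝 (0 : ℝ), charFun (Pr.map Y) t ≠ 0 :=
      continuous_charFun.continuousAt.eventually_ne (by simp)
    obtain ⟨ε, hε, hb⟩ := Metric.eventually_nhds_iff.1 h1
    exact ⟨ε / 2, by positivity, hb (by simp [abs_of_pos hε, hε])⟩
  have hnorm : Tendsto (fun n => Real.exp (-(v n * t ^ 2 / 2))) atTop
      (𝓝 ‖charFun (Pr.map Y) t‖) := by
    refine (hconv t).norm.congr fun n => ?_
    rw [Complex.norm_real, Real.norm_eq_abs, Real.abs_exp]
  have hv : Tendsto (fun n => (v n : ℝ)) atTop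
      (𝓝 (-Real.log ‖charFun (Pr.map Y) t‖ * 2 / t ^ 2)) := by
    have := (((hnorm.log (norm_ne_zero_iff.2 htne)).neg.mul_const 2).div_const (t ^ 2))
    refine this.congr fun n => ?_
    rw [Real.log_exp]
    field_simp
  set w := -Real.log ‖charFun (Pr.map Y) t‖ * 2 / t ^ 2
  have hw : 0 ≤ w := ge_of_tendsto' hv fun n => (v n).2
  have hlaw : Pr.map Y = gaussianReal 0 w.toNNReal := by
    refine Measure.ext_of_charFun (funext fun s => ?_)
    refine tendsto_nhds_unique (hconv s) ?_
    rw [charFun_gaussianReal]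
    have h1 := (Complex.continuous_ofReal.comp Real.continuous_exp).tendsto (-(w * s ^ 2 / 2))
    have h2 := h1.comp (((hv.mul_const (s ^ 2)).div_const 2).neg)
    convert h2 using 2
    simp only [Function.comp_apply, Complex.ofReal_exp]
    rw [Function.comp_apply, Complex.ofReal_exp, Real.coe_toNNReal w hw]
    push_cast
    ring_nf
  exact ⟨by rw [hlaw]; infer_instance⟩

/-- A pointwise almost sure limit of centered Gaussian processes is a Gaussian process. -/
lemma isGaussianProcess_of_tendsto {T : Type*} {X : ℕ → T → Ω → ℝ} {Y : T → Ω → ℝ}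
    (hX : ∀ n, IsGaussianProcess (X n) Pr) (hX0 : ∀ n t, ∫ ω, X n t ω ∂Pr = 0)
    (hlim : ∀ t, ∀ᵐ ω ∂Pr, Tendsto (fun n => X n t ω) atTop (𝓝 (Y t ω))) :
    IsGaussianProcess Y Pr where
  hasGaussianLaw I := by
    have hYm : ∀ t, AEMeasurable (Y t) Pr := fun t =>
      aemeasurable_of_tendsto_metrizable_ae atTop (fun n => (hX n).aemeasurable t) (hlim t)
    refine ⟨isGaussian_of_isGaussian_map fun L => ?_⟩
    have hYI : AEMeasurable (fun ω => I.restrict (Y · ω)) Pr :=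
      aemeasurable_pi_lambda _ fun t => hYm t
    rw [AEMeasurable.map_map_of_aemeasurable L.continuous.measurable.aemeasurable hYI]
    have hlimI : ∀ᵐ ω ∂Pr, ∀ t : I, Tendsto (fun n => X n t ω) atTop (𝓝 (Y t ω)) :=
      ae_all_iff.2 fun t => hlim t
    refine (hasGaussianLaw_of_tendsto (Z := fun n ω => L (I.restrict (X n · ω)))
      (Y := L ∘ fun ω => I.restrict (Y · ω)) (fun n => ((hX n).hasGaussianLaw I).map_fun L)
      (fun n => ?_) ?_).isGaussian_map
    · have hi := ((hX n).hasGaussianLaw I).integrable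
      rw [L.integral_comp_comm hi]
      have : ∫ ω, I.restrict (X n · ω) ∂Pr = 0 := by
        funext t
        rw [← ContinuousLinearMap.proj_apply (R := ℝ) (φ := fun _ : I => ℝ) t
          (∫ ω, I.restrict (X n · ω) ∂Pr), ← ContinuousLinearMap.integral_comp_comm _ hi]
        exact hX0 n t
      rw [this, map_zero]
    · filter_upwards [hlimI] with ω hω
      exact (L.continuous.tendsto _).comp (tendsto_pi_nhds.2 hω)

end GaussianLimits

/-- Uniform continuity on a period. This presents the mean of a path as a limit of finite linear
combinations of its values, to which Gaussianity applies. -/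
lemma tendsto_riemann_sum (f : C(UnitAddCircle, ℝ)) :
    Tendsto (fun n : ℕ => ((n : ℝ) + 1)⁻¹ * ∑ i : Fin (n + 1), f ((i / ((n : ℝ) + 1) : ℝ)))
      atTop (𝓝 (∫ x, f x)) := by
  set g : ℝ → ℝ := fun x => f x with hg
  have hgc : Continuous g := continuous_lift f.continuous
  have hu := isCompact_Icc (a := (0 : ℝ)) (b := 1)|>.uniformContinuousOn_of_continuous
    hgc.continuousOn
  rw [integral_circle_eq, Metric.tendsto_atTop]
  intro ε hε
  obtain ⟨δ, hδ, hd⟩ := Metric.uniformContinuousOn_iff.1 hu (ε / 2) (by positivity)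
  obtain ⟨N, hN⟩ := exists_nat_one_div_lt hδ
  refine ⟨N, fun n hn => ?_⟩
  have hn0 : (0 : ℝ) < n + 1 := by positivity
  set a : ℕ → ℝ := fun i => i / ((n : ℝ) + 1) with ha
  have hstep : ∀ i, a (i + 1) - a i = ((n : ℝ) + 1)⁻¹ := fun i => by
    simp only [ha]
    push_cast
    field_simp
    ring
  have h1 : ∫ x in (0 : ℝ)..1, g x =
      ∑ i ∈ Finset.range (n + 1), ∫ x in a i..a (i + 1), g x := by
    rw [intervalIntegral.sum_integral_adjacent_intervals fun _ _ => hgc.intervalIntegrable _ _]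
    congr 1
    · simp [ha]
    · simp only [ha]
      push_cast
      field_simp
  rw [Fin.sum_univ_eq_sum_range (fun i => f ((i / ((n : ℝ) + 1) : ℝ))) (n + 1), h1, dist_comm,
    Real.dist_eq, Finset.mul_sum, ← Finset.sum_sub_distrib]
  refine lt_of_le_of_lt (Finset.abs_sum_le_sum_abs _ _) (lt_of_le_of_lt
    (b := ∑ i ∈ Finset.range (n + 1), ε / 2 * ((n : ℝ) + 1)⁻¹) (Finset.sum_le_sum fun i hi => ?_) ?_)
  · have hle : a i ≤ a (i + 1) := by
      have := hstep i
      have : 0 < ((n : ℝ) + 1)⁻¹ := by positivity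
      linarith
    have hai : 0 ≤ a i := by positivity
    have hai1 : a (i + 1) ≤ 1 := by
      rw [ha, div_le_one hn0]
      exact_mod_cast Nat.succ_le_of_lt (Finset.mem_range.1 hi)
    have h2 : ((n : ℝ) + 1)⁻¹ * g (a i) = ∫ x in a i..a (i + 1), g (a i) := by
      rw [intervalIntegral.integral_const, hstep, smul_eq_mul]
    change |_ - ((n : ℝ) + 1)⁻¹ * g (a i)| ≤ _
    rw [h2, ← intervalIntegral.integral_sub (hgc.intervalIntegrable _ _)
      (continuous_const.intervalIntegrable _ _), ← Real.norm_eq_abs]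
    refine (intervalIntegral.norm_integral_le_of_norm_le_const (C := ε / 2) fun x hx => ?_).trans ?_
    · rw [uIoc_of_le hle] at hx
      rw [← dist_eq_norm]
      refine (hd x ⟨by linarith [hx.1], by linarith [hx.2]⟩ (a i) ⟨hai, by linarith⟩ ?_).le
      rw [Real.dist_eq, abs_of_pos (by linarith [hx.1])]
      have h3 : ((n : ℝ) + 1)⁻¹ ≤ 1 / ((N : ℝ) + 1) := by
        rw [one_div]
        gcongr
      linarith [hx.2, hstep i]
    · rw [hstep, abs_of_pos (by positivity)]
  · rw [Finset.sum_const, Finset.card_range, nsmul_eq_mul]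
    push_cast
    field_simp
    linarith

/-! ### The mean and the mean-zero part of the Gaussian potential -/

section Potential

variable {Ω : Type*} [MeasurableSpace Ω] {Pr : Measure Ω} {q : UnitAddCircle → Ω → ℝ}
  {K : UnitAddCircle → ℝ}

/-- The mean `∫ q` of the random potential. -/
noncomputable def pathMean (q : UnitAddCircle → Ω → ℝ) (ω : Ω) : ℝ := ∫ x, path q ω x

namespace IsGaussianPotential

lemma ae_path (hq : IsGaussianPotential Pr q K) : ∀ᵐ ω ∂Pr, ∀ x, path q ω x = q x ω := by
  filter_upwards [hq.ae_continuous] with ω hω x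
  rw [path, dif_pos hω]
  rfl

lemma aemeasurable_path (hq : IsGaussianPotential Pr q K) : AEMeasurable (path q) Pr :=
  aemeasurable_of_eval fun x => (hq.gaussian.aemeasurable x).congr
    (hq.ae_path.mono fun _ h => (h x).symm)

lemma aemeasurable_pathMean (hq : IsGaussianPotential Pr q K) : AEMeasurable (pathMean q) Pr :=
  continuous_integral.measurable.comp_aemeasurable hq.aemeasurable_path

lemma memLp (hq : IsGaussianPotential Pr q K) (x : UnitAddCircle) : MemLp (q x) 2 Pr :=
  (hq.gaussian.hasGaussianLaw_eval x).memLp_two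

lemma ae_groundState_eq (hq : IsGaussianPotential Pr q K) :
    (fun ω => groundState fun x => q x ω) =ᵐ[Pr]
      fun ω => pathMean q ω - Phi (tilde (path q ω)) := by
  filter_upwards [hq.ae_path] with ω hω
  rw [← show ⇑(path q ω) = fun x => q x ω from funext hω]
  exact groundState_eq_integral_sub_Phi (path q ω)

variable [IsProbabilityMeasure Pr]

/-- Fubini, justified by `|W q(y)| ≤ W² + q(y)²`, whose expectation `E[W²] + K 0` does not depend on
`y`. -/
lemma integral_mul_pathMean (hq : IsGaussianPotential Pr q K) {W : Ω → ℝ} (hW : MemLp W 2 Pr) :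
    ∫ ω, W ω * pathMean q ω ∂Pr = ∫ y, ∫ ω, W ω * q y ω ∂Pr := by
  have hae : ∀ y, (fun ω => W ω * path q ω y) =ᵐ[Pr] fun ω => W ω * q y ω := fun y =>
    hq.ae_path.mono fun ω h => by simp only [h y]
  have hpm : AEMeasurable (fun z : Ω × UnitAddCircle => path q z.1 z.2) (Pr.prod volume) := by
    have h1 : Measurable fun z : C(UnitAddCircle, ℝ) × UnitAddCircle => z.1 z.2 :=
      (show Continuous fun z : C(UnitAddCircle, ℝ) × UnitAddCircle => z.1 z.2 from
        ContinuousEval.continuous_eval).measurable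
    exact h1.comp_aemeasurable
      ((hq.aemeasurable_path.comp_quasiMeasurePreserving
        Measure.quasiMeasurePreserving_fst).prodMk measurable_snd.aemeasurable)
  have hm : AEStronglyMeasurable (fun z : Ω × UnitAddCircle => W z.1 * path q z.1 z.2)
      (Pr.prod volume) :=
    ((hW.1.aemeasurable.comp_quasiMeasurePreserving
      Measure.quasiMeasurePreserving_fst).mul hpm).aestronglyMeasurable
  have hint : ∀ y, Integrable (fun ω => W ω * path q ω y) Pr := fun y =>
    (hW.integrable_mul (hq.memLp y)).congr (hae y).symm
  have hI : Integrable (fun z : Ω × UnitAddCircle => W z.1 * path q z.1 z.2)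
      (Pr.prod volume) := by
    rw [integrable_prod_iff' hm]
    refine ⟨Eventually.of_forall hint, Integrable.of_bound (C := ∫ ω, W ω ^ 2 ∂Pr + K 0)
      hm.norm.prod_swap.integral_prod_right' (Eventually.of_forall fun y => ?_)⟩
    have h1 : K 0 = ∫ ω, q y ω ^ 2 ∂Pr := by
      rw [← sub_self y, ← hq.covariance y y]
      simp only [sq]
    rw [Real.norm_eq_abs, abs_of_nonneg (integral_nonneg fun ω => norm_nonneg _), h1,
      ← integral_add hW.integrable_sq (hq.memLp y).integrable_sq]
    refine integral_mono_ae (hint y).norm (hW.integrable_sq.add (hq.memLp y).integrable_sq) ?_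
    filter_upwards [hq.ae_path] with ω hω
    simp only [hω y, Real.norm_eq_abs]
    exact abs_le.2 ⟨by nlinarith [sq_nonneg (W ω + q y ω)], by nlinarith [sq_nonneg (W ω - q y ω)]⟩
  calc ∫ ω, W ω * pathMean q ω ∂Pr = ∫ ω, (∫ y, W ω * path q ω y) ∂Pr := by
        simp only [pathMean, integral_const_mul]
    _ = ∫ y, ∫ ω, W ω * path q ω y ∂Pr := integral_integral_swap hI
    _ = ∫ y, ∫ ω, W ω * q y ω ∂Pr := integral_congr_ae (Eventually.of_forall fun y =>
        integral_congr_ae (hae y))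

lemma integral_pathMean (hq : IsGaussianPotential Pr q K) : ∫ ω, pathMean q ω ∂Pr = 0 := by
  have := hq.integral_mul_pathMean (W := fun _ => 1) (memLp_const 1)
  simpa [hq.mean_zero] using this

/-- The mean and the mean-zero part must be jointly Gaussian for zero covariance to imply
independence, hence one process indexed by `Unit ⊕ UnitAddCircle`. Replacing the mean by Riemann
sums gives finite linear images of `q`, which converge almost surely. -/
lemma isGaussianProcess_pathMean (hq : IsGaussianPotential Pr q K) :
    IsGaussianProcess (Sum.elim (fun _ : Unit => pathMean q)
      fun x ω => (tilde (path q ω)).1 x) Pr := by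
  classical
  let pt : (n : ℕ) → Fin (n + 1) → UnitAddCircle := fun n i => ((i / ((n : ℝ) + 1) : ℝ))
  let S : ℕ → Ω → ℝ := fun n ω => ((n : ℝ) + 1)⁻¹ * ∑ i : Fin (n + 1), q (pt n i) ω
  have hqi : ∀ x, Integrable (q x) Pr := fun x => (hq.memLp x).integrable one_le_two
  have hSi : ∀ n, Integrable (S n) Pr := fun n =>
    (integrable_finsetSum _ fun i _ => hqi _).const_mul _
  have hS0 : ∀ n, ∫ ω, S n ω ∂Pr = 0 := fun n => by
    simp only [S]
    rw [integral_const_mul, integral_finsetSum _ fun i _ => hqi _]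
    simp [hq.mean_zero]
  have hS : ∀ᵐ ω ∂Pr, Tendsto (fun n => S n ω) atTop (𝓝 (pathMean q ω)) := by
    filter_upwards [hq.ae_path] with ω hω
    have := tendsto_riemann_sum (path q ω)
    simp_rw [hω (_ : ℝ)] at this
    simpa only [S, pt, pathMean, hω] using this
  refine isGaussianProcess_of_tendsto
    (X := fun n => Sum.elim (fun _ : Unit => S n) fun x ω => q x ω - S n ω)
    (fun n => hq.gaussian.of_isGaussianProcess ?_) ?_ ?_
  · let L : (I : Finset UnitAddCircle) → (∀ i, pt n i ∈ I) → ((I → ℝ) →L[ℝ] ℝ) := fun I hI =>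
      ((n : ℝ) + 1)⁻¹ • ∑ i : Fin (n + 1),
        ContinuousLinearMap.proj (R := ℝ) (φ := fun _ : I => ℝ) ⟨pt n i, hI i⟩
    have hL : ∀ I hI ω, L I hI (I.restrict (q · ω)) = S n ω := fun I hI ω => by
      simp [L, S]
    rintro (_ | x)
    · exact ⟨Finset.univ.image (pt n), L _ fun i => by simp, fun ω => (hL _ _ ω).symm⟩
    · refine ⟨insert x (Finset.univ.image (pt n)),
        ContinuousLinearMap.proj (R := ℝ) (φ := fun _ => ℝ) ⟨x, by simp⟩ - L _ fun i => by simp,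
        fun ω => ?_⟩
      rw [sub_apply, hL]
      rfl
  · rintro n (_ | x)
    · exact hS0 n
    · simp only [Sum.elim_inr]
      rw [integral_sub (hqi x) (hSi n), hS0, hq.mean_zero, sub_zero]
  · rintro (_ | x)
    · exact hS
    · filter_upwards [hS, hq.ae_path] with ω h1 h2
      have : (tilde (path q ω)).1 x = q x ω - pathMean q ω := by
        rw [← h2 x]
        rfl
      simpa only [Sum.elim_inr, this] using h1.const_sub (q x ω)

lemma hasGaussianLaw_pathMean (hq : IsGaussianPotential Pr q K) :
    HasGaussianLaw (pathMean q) Pr :=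
  hq.isGaussianProcess_pathMean.hasGaussianLaw_eval (Sum.inl ())

lemma integral_mul_pathMean_eq_one (hq : IsGaussianPotential Pr q K)
    (hK : ∀ x, covOp K (fun _ => 1) x = 1) (x : UnitAddCircle) :
    ∫ ω, q x ω * pathMean q ω ∂Pr = 1 := by
  rw [hq.integral_mul_pathMean (hq.memLp x)]
  simpa only [hq.covariance, covOp, mul_one] using hK x

lemma integral_pathMean_mul_self (hq : IsGaussianPotential Pr q K)
    (hK : ∀ x, covOp K (fun _ => 1) x = 1) : ∫ ω, pathMean q ω * pathMean q ω ∂Pr = 1 := by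
  rw [hq.integral_mul_pathMean hq.hasGaussianLaw_pathMean.memLp_two]
  simp_rw [mul_comm (pathMean q _), hq.integral_mul_pathMean_eq_one hK]
  simp [Measure.real]

lemma map_pathMean (hq : IsGaussianPotential Pr q K) (hK : ∀ x, covOp K (fun _ => 1) x = 1) :
    Pr.map (pathMean q) = gaussianReal 0 1 := by
  rw [hq.hasGaussianLaw_pathMean.map_eq_gaussianReal, hq.integral_pathMean,
    variance_of_integral_eq_zero hq.aemeasurable_pathMean hq.integral_pathMean]
  simp only [sq, hq.integral_pathMean_mul_self hK, Real.toNNReal_one]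

/-- With `m` the mean, `E[m (q(x) - m)] = 1 - 1 = 0`, so `m` is independent of the family of values
of `q̃`. -/
lemma indepFun_pathMean_tilde (hq : IsGaussianPotential Pr q K)
    (hK : ∀ x, covOp K (fun _ => 1) x = 1) :
    IndepFun (pathMean q) (fun ω => tilde (path q ω)) Pr := by
  have hG := hq.isGaussianProcess_pathMean
  have hm2 := hq.hasGaussianLaw_pathMean.memLp_two
  have hind := hG.indepFun_of_covariance_eq_zero (fun _ => hG.aemeasurable (Sum.inl ()))
    (fun x => hG.aemeasurable (Sum.inr x)) fun _ x => by
      have hae : (fun ω => (tilde (path q ω)).1 x) =ᵐ[Pr] q x - pathMean q :=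
        hq.ae_path.mono fun ω h => by
          rw [Pi.sub_apply, ← h x]
          rfl
      have hcov : cov[pathMean q, fun ω => (tilde (path q ω)).1 x; Pr] =
          cov[pathMean q, q x - pathMean q; Pr] := by
        rw [ProbabilityTheory.covariance, ProbabilityTheory.covariance, integral_congr_ae hae]
        exact integral_congr_ae (hae.mono fun ω h => by simp only [h])
      rw [hcov, covariance_sub_right hm2 (hq.memLp x) hm2,
        covariance_eq_sub hm2 (hq.memLp x), covariance_eq_sub hm2 hm2, hq.integral_pathMean]
      simp only [Pi.mul_apply, hq.integral_pathMean_mul_self hK, mul_comm (pathMean q _),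
        hq.integral_mul_pathMean_eq_one hK]
      simp
  -- Independence passes from the family of point values to the path in `H`: its Borel σ-algebra is
  -- already generated by the evaluations at a dense sequence.
  rw [IndepFun_iff_Indep] at hind ⊢
  refine indep_of_indep_of_le_left (indep_of_indep_of_le_right hind ?_) ?_
  · rw [← measurable_iff_comap_le]
    let _ : MeasurableSpace Ω :=
      MeasurableSpace.comap (fun ω x => (tilde (path q ω)).1 x) inferInstance
    refine Measurable.subtype_mk (f := fun ω => (tilde (path q ω)).1) ?_
    obtain ⟨d, hd⟩ := TopologicalSpace.exists_dense_seq UnitAddCircle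
    exact measurable_of_denseRange hd fun k => (measurable_pi_apply (d k)).comp
      (comap_measurable fun ω x => (tilde (path q ω)).1 x)
  · rw [← measurable_iff_comap_le]
    exact (measurable_pi_apply ()).comp (comap_measurable fun ω (_ : Unit) => pathMean q ω)

end IsGaussianPotential

end Potential

end Hill

theorem theorem2 {Ω : Type*} [MeasurableSpace Ω] (Pr : MeasureTheory.Measure Ω)
    [MeasureTheory.IsProbabilityMeasure Pr]
    (q : UnitAddCircle → Ω → ℝ) (K : UnitAddCircle → ℝ)
    (hq : Hill.IsGaussianPotential Pr q K)
    (hK : ∀ x, Hill.covOp K (fun _ => 1) x = 1) :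
    -- the ground state eigenvalue is the least element of a set that has one
    (∀ᵐ ω ∂Pr, IsLeast (Hill.eigenvalues fun x => q x ω) (Hill.groundState fun x => q x ω)) ∧
    -- the functional `Φ` is well defined and nonnegative
    (∀ g : Hill.H, ∃! p : ℝ → ℝ, Hill.IsZeroMultiplierSolution g.1 p) ∧
    (∀ g : Hill.H, 0 ≤ Hill.Phi g) ∧
    -- `f` is the probability density of `Λ₀(q)`
    AEMeasurable (fun ω => Hill.groundState fun x => q x ω) Pr ∧
    Pr.map (fun ω => Hill.groundState fun x => q x ω) =
      MeasureTheory.volume.withDensity (fun t => ENNReal.ofReal (Hill.density Pr q t)) ∧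
    -- `f` is smooth and strictly positive
    ContDiff ℝ ((⊤ : ℕ∞) : WithTop ℕ∞) (Hill.density Pr q) ∧
    (∀ t, 0 < Hill.density Pr q t) := by
  have hT : AEMeasurable (fun ω => Hill.tilde (Hill.path q ω)) Pr :=
    Hill.continuous_tilde.measurable.comp_aemeasurable hq.aemeasurable_path
  have hlaw : Hill.tildeLaw Pr q = Pr.map fun ω => Hill.tilde (Hill.path q ω) :=
    AEMeasurable.map_map_of_aemeasurable Hill.continuous_tilde.measurable.aemeasurable
      hq.aemeasurable_path
  have hprob : IsProbabilityMeasure (Hill.tildeLaw Pr q) := by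
    rw [hlaw]
    exact Measure.isProbabilityMeasure_map hT
  have hgs := hq.ae_groundState_eq
  refine ⟨hq.ae_continuous.mono fun ω hω => Hill.isLeast_groundState hω,
    fun g => Hill.existsUnique_isZeroMultiplierSolution g.1.continuous, Hill.Phi_nonneg,
    (hq.aemeasurable_pathMean.sub (Hill.measurable_Phi.comp_aemeasurable hT)).congr hgs.symm,
    ?_, contDiff_const.mul (Hill.contDiff_integral_gaussian Hill.measurable_Phi), fun t => ?_⟩
  · rw [Measure.map_congr hgs, Hill.map_sub_eq_withDensity hq.aemeasurable_pathMean hT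
      (hq.indepFun_pathMean_tilde hK) (hq.map_pathMean hK) Hill.measurable_Phi, ← hlaw]
    rfl
  · exact mul_pos (by positivity)
      (integral_exp_pos (Hill.integrable_gaussian Hill.measurable_Phi t))
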